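/- Let $n\ge 2$ and $d$ be integers with $d\ge 3$ if $n=2$ and $d\ge 2$ otherwise, and let $k$ be a field whose characteristic does not divide $(d+1)!$ (for instance, of characteristic $0$). Let $V$ be the space of linear forms in $S=k[x_1,\dots,x_n]$. For a form $g\in S$ of degree $d+1$, let $E(g)\subset V$ be the space of all linear forms obtained by applying to $g$ a homogeneous differential operator of order $d$ with constant coefficients, i.e. a form of degree $d$ in $\partial/\partial x_1,\dots,\partial/\partial x_n$. For a subspace $E\subset V$, say that $g$ is a direct sum in $\operatorname{Sym}^{d+1}E$ if there are subspaces $U,W$ with $E=U\oplus W$ and nonzero $g_1\in\operatorname{Sym}^{d+1}U$, $g_2\in\operatorname{Sym}^{d+1}W$ such that $g=g_1+g_2$. A maximally fine direct sum decomposition of a form $f$ of degree $d+1$ is an expression $f=f_1+\cdots+f_r$ with nonzero forms $f_i$ of degree $d+1$ such that $V=E(f_1)\oplus\cdots\oplus E(f_r)$ and, for every $i$, $f_i$ is not a direct sum in $\operatorname{Sym}^{d+1}E(f_i)$. Let $f\in S$ be a form of degree $d+1$ that is smooth, i.e. the hypersurface $f=0$ in $\mathbb{P}^{n-1}$ has no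 singular points over the algebraic closure of $k$: at no point of $\mathbb{P}^{n-1}(\bar k)$ do $f$ and all $\partial f/\partial x_i$ vanish simultaneously. Then $f$ has a maximally fine direct sum decomposition, and it is unique up to the order of the summands: if $f=f_1+\cdots+f_r=g_1+\cdots+g_s$ are two such decompositions, then $r=s$ and, after reordering, $f_i=g_i$ for all $i$. -/

import Mathlib

/-! Throughout, `S = MvPolynomial (Fin n) k` is the symmetric algebra of the `n`-dimensional vector
space `V = S_1 = ⟨x_1, …, x_n⟩` of linear forms.  The dual symmetric algebra is again identified
with a polynomial ring in `n` variables, by means of the dual basis. -/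

noncomputable section

namespace SmoothForm

open MvPolynomial

variable {k : Type*} [Field k] {n : ℕ}

/-- The space `V = S_1` of linear forms. -/
def linearForms (k : Type*) [Field k] (n : ℕ) : Submodule k (MvPolynomial (Fin n) k) :=
  homogeneousSubmodule (Fin n) k 1

/-- The differential operator `(∂/∂x_1)^{m_1} ⋯ (∂/∂x_n)^{m_n}`. -/
def iteratedPartial (m : Fin n →₀ ℕ) : Module.End k (MvPolynomial (Fin n) k) :=
  (List.ofFn fun i : Fin n =>
    ((pderiv i).toLinearMap : Module.End k (MvPolynomial (Fin n) k)) ^ m i).prod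

/-- The polar pairing `(g, f) ↦ g ∘ f = g(∂/∂x_1, …, ∂/∂x_n) f`: the `k`-linear extension in `g` of
`x^m ∘ f = ∂^m f`. -/
def polarPairing :
    MvPolynomial (Fin n) k →ₗ[k] MvPolynomial (Fin n) k →ₗ[k] MvPolynomial (Fin n) k :=
  (basisMonomials (Fin n) k).constr k iteratedPartial

/-- The space of essential variables of a form `f` of degree `d + 1`:
`E(f) = {g ∘ f | g a form of degree d}`, a subspace of `V`. -/
def essentialVars (d : ℕ) (f : MvPolynomial (Fin n) k) : Submodule k (MvPolynomial (Fin n) k) :=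
  (homogeneousSubmodule (Fin n) k d).map (polarPairing.flip f)

/-- A form `f` is smooth: the hypersurface `f = 0` in projective `(n-1)`-space has no singular point
over the algebraic closure of `k`. -/
def IsSmooth (f : MvPolynomial (Fin n) k) : Prop :=
  ∀ p : Fin n → AlgebraicClosure k, p ≠ 0 → aeval p f = 0 → ∃ i, aeval p (pderiv i f) ≠ 0

/-- For a space `E` of linear forms, `f` is a direct sum in `Sym^{d+1} E`: there are a
decomposition `E = U ⊕ W` and nonzero `f₁ ∈ Sym^{d+1} U`, `f₂ ∈ Sym^{d+1} W` with `f = f₁ + f₂`.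
Here `Sym^{d+1} U` is the span `U ^ (d + 1)` of all products of `d + 1` elements of `U`. -/
def IsDirectSumIn (d : ℕ) (E : Submodule k (MvPolynomial (Fin n) k))
    (f : MvPolynomial (Fin n) k) : Prop :=
  ∃ U W : Submodule k (MvPolynomial (Fin n) k), Disjoint U W ∧ U ⊔ W = E ∧
    ∃ f₁ ∈ U ^ (d + 1), ∃ f₂ ∈ W ^ (d + 1), f₁ ≠ 0 ∧ f₂ ≠ 0 ∧ f = f₁ + f₂

/-- `f = F 0 + ⋯ + F (r - 1)` is a maximally fine direct sum decomposition of the form `f` of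
degree `d + 1`: the summands are nonzero forms of degree `d + 1`, `V` is the internal direct sum of
the `E(F i)`, and no `F i` is a direct sum in `Sym^{d+1} E(F i)`. -/
structure IsMaximallyFine (d : ℕ) (f : MvPolynomial (Fin n) k) {r : ℕ}
    (F : Fin r → MvPolynomial (Fin n) k) : Prop where
  isHomogeneous : ∀ i, (F i).IsHomogeneous (d + 1)
  ne_zero : ∀ i, F i ≠ 0
  sum_eq : f = ∑ i, F i
  independent : iSupIndep fun i => essentialVars d (F i)
  iSup_eq : ⨆ i, essentialVars d (F i) = linearForms k n
  not_isDirectSum : ∀ i, ¬ IsDirectSumIn d (essentialVars d (F i)) (F i)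

end SmoothForm

end

noncomputable section

namespace SmoothForm

open MvPolynomial

variable {k : Type*} [Field k] {n : ℕ}

/-! Write `D_v` for the derivative in the direction `v`, where `v` ranges over `k^n`, the dual of
`V`. Smoothness enters only through nondegeneracy: if `D_c f = 0`, Euler's formula at the point `c`
makes `f` and all its partial derivatives vanish there, so `c = 0`
(`IsSmooth.eq_zero_of_dirDeriv_eq_zero`). Consequently `E(f) = V`.

Decompositions are encoded by linear algebra. The projections of `V` onto the `E(F a)` transpose to
complete orthogonal idempotents `P a` of `k^n` with `D_v (F a) = D_{P a v} f`
(`IsDecomposition.exists_idempotents`). Symmetry of second derivatives makes each `P a` self-adjoint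
for `f`. Since `f` has degree at least three and is nondegenerate, any two self-adjoint operators
commute (`IsSelfAdjointFor.commute`).

Conversely, writing `P a` as a sum of two nonzero orthogonal self-adjoint idempotents splits `F a`
as a direct sum (`isDirectSumIn_potential`). In a maximally fine decomposition `P a` therefore
cannot be split, so `P a * Q` is `0` or `P a` for every self-adjoint idempotent `Q`. Two such
families of idempotents must coincide up to order, and by Euler's formula so do the forms.

Existence is by refinement of the one-term decomposition, which stops because there are at most `n`
summands. -/

/-! ### Directional derivatives and Euler's formula -/

/-- The derivative in the direction `v`, as a linear function of `v`. -/
def dirDeriv : (Fin n → k) →ₗ[k] Derivation k (MvPolynomial (Fin n) k) (MvPolynomial (Fin n) k) where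
  toFun v := mkDerivation k fun i => C (v i)
  map_add' v w := derivation_ext fun i => by simp [mkDerivation_X]
  map_smul' c v := derivation_ext fun i => by simp [mkDerivation_X, smul_eq_C_mul]

@[simp]
theorem dirDeriv_X (v : Fin n → k) (i : Fin n) : dirDeriv v (X i) = C (v i) :=
  mkDerivation_X _ _ _

theorem dirDeriv_single (i : Fin n) : dirDeriv (Pi.single i (1 : k)) = pderiv i :=
  derivation_ext fun j => by
    rw [dirDeriv_X, pderiv_X, Pi.single_apply, Pi.single_apply]
    split_ifs <;> simp

theorem dirDeriv_comm (v w : Fin n → k) (p : MvPolynomial (Fin n) k) :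
    dirDeriv v (dirDeriv w p) = dirDeriv w (dirDeriv v p) := by
  have h : ⁅dirDeriv v, dirDeriv w⁆ = 0 := derivation_ext fun i => by
    simp [Derivation.commutator_apply]
  have := congrArg (fun D => D p) h
  simpa [Derivation.commutator_apply, sub_eq_zero] using this

theorem dirDeriv_apply (v : Fin n → k) (p : MvPolynomial (Fin n) k) :
    dirDeriv v p = ∑ i, v i • pderiv i p := by
  have hv : v = ∑ i, v i • Pi.single i (1 : k) := by
    ext j; simp [Pi.single_apply]
  conv_lhs => rw [hv]
  rw [map_sum, ← Derivation.coeFnAddMonoidHom_apply, map_sum, Finset.sum_apply]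
  simp [dirDeriv_single]

theorem dirDeriv_mem {m : ℕ} {p : MvPolynomial (Fin n) k} (hp : p.IsHomogeneous (m + 1))
    (v : Fin n → k) : (dirDeriv v p).IsHomogeneous m := by
  rw [dirDeriv_apply]
  exact IsHomogeneous.sum _ _ _ fun i _ => by
    rw [smul_eq_C_mul]
    simpa using (isHomogeneous_C (Fin n) (v i)).mul (hp.pderiv (i := i))

theorem sum_X_mul_dirDeriv {m : ℕ} {p : MvPolynomial (Fin n) k} (hp : p.IsHomogeneous m) :
    ∑ i, X i * dirDeriv (Pi.single i 1) p = (m : k) • p := by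
  simp_rw [dirDeriv_single]
  rw [hp.sum_X_mul_pderiv, Nat.cast_smul_eq_nsmul]

/-- A form of degree invertible in `k` is determined by its derivatives. -/
theorem ext_dirDeriv {m : ℕ} (hm : (m : k) ≠ 0) {p q : MvPolynomial (Fin n) k}
    (hp : p.IsHomogeneous m) (hq : q.IsHomogeneous m) (h : ∀ v, dirDeriv v p = dirDeriv v q) :
    p = q := by
  have := sum_X_mul_dirDeriv hp
  simp_rw [h] at this
  rw [sum_X_mul_dirDeriv hq] at this
  exact (smul_right_injective _ hm this).symm

theorem natCast_ne_zero_of_factorial {d m : ℕ} (hd : (d.factorial : k) ≠ 0) (hm : m ≠ 0)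
    (hmd : m ≤ d) : (m : k) ≠ 0 := by
  obtain ⟨c, hc⟩ := Nat.dvd_factorial (Nat.pos_of_ne_zero hm) hmd
  rw [hc, Nat.cast_mul] at hd
  exact left_ne_zero_of_mul hd

/-! ### The polar pairing -/

theorem list_prod_ofFn_pow_add_single {M : Type*} [Monoid M] {m : ℕ} (a : Fin m → M)
    (ha : ∀ i j, Commute (a i) (a j)) (e : Fin m → ℕ) (i : Fin m) :
    (List.ofFn fun j => a j ^ (e j + if j = i then 1 else 0)).prod =
      (List.ofFn fun j => a j ^ e j).prod * a i := by
  induction m with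
  | zero => exact i.elim0
  | succ m ih =>
    rw [List.ofFn_succ, List.ofFn_succ, List.prod_cons, List.prod_cons]
    refine Fin.cases ?_ (fun i => ?_) i
    · have hc : Commute (a 0) (List.ofFn fun j : Fin m => a j.succ ^ e j.succ).prod := by
        refine Commute.list_prod_right _ _ fun x hx => ?_
        obtain ⟨j, rfl⟩ := (List.mem_ofFn' _ _).1 hx
        exact (ha _ _).pow_right _
      simp only [if_true, Fin.succ_ne_zero, if_false, add_zero, pow_succ, mul_assoc, hc.eq]
    · have h0 : (0 : Fin (m + 1)) ≠ i.succ := (Fin.succ_ne_zero i).symm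
      simp only [if_neg h0, add_zero, Fin.succ_inj, mul_assoc]
      rw [ih (fun j => a j.succ) (fun _ _ => ha _ _)]

theorem commute_pderiv (i j : Fin n) :
    Commute ((pderiv i).toLinearMap : Module.End k (MvPolynomial (Fin n) k))
      (pderiv j).toLinearMap := by
  refine LinearMap.ext fun p => ?_
  simpa [dirDeriv_single] using dirDeriv_comm (Pi.single i (1 : k)) (Pi.single j 1) p

theorem iteratedPartial_add_single (m : Fin n →₀ ℕ) (i : Fin n) :
    (iteratedPartial (m + Finsupp.single i 1) : Module.End k (MvPolynomial (Fin n) k)) =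
      iteratedPartial m * (pderiv i).toLinearMap := by
  unfold iteratedPartial
  rw [← list_prod_ofFn_pow_add_single _ commute_pderiv]
  congr! with j
  simp [Finsupp.single_apply, eq_comm]

theorem iteratedPartial_add_single_apply (m : Fin n →₀ ℕ) (i : Fin n)
    (p : MvPolynomial (Fin n) k) : iteratedPartial (m + Finsupp.single i 1) p =
      iteratedPartial m (dirDeriv (Pi.single i 1) p) := by
  rw [iteratedPartial_add_single, dirDeriv_single]
  rfl

theorem iteratedPartial_zero :
    (iteratedPartial 0 : Module.End k (MvPolynomial (Fin n) k)) = 1 := by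
  simp [iteratedPartial]

theorem polarPairing_monomial (m : Fin n →₀ ℕ) (a : k) :
    polarPairing (monomial m a) = a • iteratedPartial m := by
  have h : monomial m a = a • basisMonomials (Fin n) k m := by
    simp [smul_monomial]
  rw [h, map_smul, polarPairing, Module.Basis.constr_basis]

theorem polarPairing_mul_X (g h : MvPolynomial (Fin n) k) (i : Fin n) :
    polarPairing (g * X i) h = polarPairing g (pderiv i h) := by
  induction g using MvPolynomial.induction_on' with
  | monomial m a =>
    rw [X, monomial_mul, mul_one, polarPairing_monomial, polarPairing_monomial,
      iteratedPartial_add_single]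
    rfl
  | add p q hp hq => simp [add_mul, hp, hq]

theorem polarPairing_one (h : MvPolynomial (Fin n) k) : polarPairing 1 h = h := by
  have h1 : (1 : MvPolynomial (Fin n) k) = monomial 0 1 := rfl
  rw [h1, polarPairing_monomial, iteratedPartial_zero]
  simp

theorem finsupp_induction_add_single {p : (Fin n →₀ ℕ) → Prop} (zero : p 0)
    (add : ∀ m i, p m → p (m + Finsupp.single i 1)) (m : Fin n →₀ ℕ) : p m := by
  induction m using Finsupp.induction with
  | zero => exact zero
  | single_add i b m _ _ ih =>
    clear * - ih add
    induction b with
    | zero => simpa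
    | succ b hb =>
      have := add _ i hb
      rwa [add_right_comm, ← Finsupp.single_add] at this

theorem polarPairing_dirDeriv (g h : MvPolynomial (Fin n) k) (v : Fin n → k) :
    polarPairing g (dirDeriv v h) = dirDeriv v (polarPairing g h) := by
  induction g using MvPolynomial.induction_on' with
  | monomial m a =>
    simp only [polarPairing_monomial, LinearMap.smul_apply, Derivation.map_smul]
    congr 1
    induction m using finsupp_induction_add_single generalizing h with
    | zero => simp [iteratedPartial_zero]
    | add m i ih =>
      rw [iteratedPartial_add_single_apply, iteratedPartial_add_single_apply, dirDeriv_comm, ih]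
  | add p q hp hq => simp [hp, hq]

/-- Differentiating `d` times moves down `d` steps in a sequence of subspaces whose derivatives go
one step down. -/
theorem polarPairing_mem {A : ℕ → Submodule k (MvPolynomial (Fin n) k)}
    (hA : ∀ e v, ∀ h ∈ A (e + 1), dirDeriv v h ∈ A e) {d e : ℕ} {g h : MvPolynomial (Fin n) k}
    (hg : g.IsHomogeneous d) (hh : h ∈ A (e + d)) : polarPairing g h ∈ A e := by
  have key : ∀ m : Fin n →₀ ℕ, ∀ h ∈ A (e + m.degree), iteratedPartial m h ∈ A e := by
    intro m
    induction m using finsupp_induction_add_single with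
    | zero => intro h hh; simpa [iteratedPartial_zero] using hh
    | add m i ih =>
      intro h hh
      rw [iteratedPartial_add_single_apply]
      refine ih _ (hA _ _ _ ?_)
      simpa [add_assoc] using hh
  rw [g.as_sum, map_sum, LinearMap.sum_apply]
  refine Submodule.sum_mem _ fun m hm => ?_
  rw [polarPairing_monomial]
  refine Submodule.smul_mem _ _ (key m h ?_)
  have : m.degree = d := by
    rw [← hg (mem_support_iff.1 hm), Finsupp.degree_eq_weight_one]; rfl
  rwa [this]

theorem essentialVars_le_linearForms {d : ℕ} {h : MvPolynomial (Fin n) k}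
    (hh : h.IsHomogeneous (d + 1)) : essentialVars d h ≤ linearForms k n := by
  rintro _ ⟨g, hg, rfl⟩
  rw [LinearMap.flip_apply]
  have hh' : h ∈ homogeneousSubmodule (Fin n) k (1 + d) := by
    rwa [add_comm, mem_homogeneousSubmodule]
  exact polarPairing_mem (A := homogeneousSubmodule (Fin n) k) (e := 1)
    (fun e v h hh => dirDeriv_mem hh v) hg hh'

theorem mem_essentialVars {d : ℕ} {g h : MvPolynomial (Fin n) k} (hg : g.IsHomogeneous d) :
    polarPairing g h ∈ essentialVars d h := ⟨g, hg, rfl⟩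

/-- Nondegeneracy of the pairing between forms of equal degree: operators `g * X i` test each
partial derivative of `h`, which vanishes by induction, and Euler's formula recovers `h`. -/
theorem eq_zero_of_polarPairing_eq_zero {m : ℕ} (hm : (m.factorial : k) ≠ 0)
    {h : MvPolynomial (Fin n) k} (hh : h.IsHomogeneous m)
    (h0 : ∀ g : MvPolynomial (Fin n) k, g.IsHomogeneous m → polarPairing g h = 0) : h = 0 := by
  induction m generalizing h with
  | zero => simpa [polarPairing_one] using h0 1 (isHomogeneous_one _ _)
  | succ m ih =>
    refine ext_dirDeriv (natCast_ne_zero_of_factorial hm m.succ_ne_zero le_rfl) hh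
      (isHomogeneous_zero _ _ _) fun v => ?_
    rw [map_zero, dirDeriv_apply]
    refine Finset.sum_eq_zero fun i _ => ?_
    rw [ih (h := pderiv i h), smul_zero]
    · rw [Nat.factorial_succ, Nat.cast_mul] at hm
      exact right_ne_zero_of_mul hm
    · rw [← dirDeriv_single]; exact dirDeriv_mem hh _
    · intro g hg
      rw [← polarPairing_mul_X]
      exact h0 _ (hg.mul (isHomogeneous_X _ _))

/-! ### Linear forms and spaces of essential variables -/

theorem dirDeriv_eq_C {p : MvPolynomial (Fin n) k} (hp : p ∈ linearForms k n) (v : Fin n → k) :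
    ∃ c : k, dirDeriv v p = C c := by
  have := dirDeriv_mem (m := 0) hp v
  exact ⟨_, totalDegree_eq_zero_iff_eq_C.1 (Nat.le_zero.1 this.totalDegree_le)⟩

theorem dirDeriv_dirDeriv_linearForms {p : MvPolynomial (Fin n) k} (hp : p ∈ linearForms k n)
    (v w : Fin n → k) : dirDeriv v (dirDeriv w p) = 0 := by
  obtain ⟨c, hc⟩ := dirDeriv_eq_C hp w
  rw [hc, derivation_C]

theorem exists_eq_sum_X {p : MvPolynomial (Fin n) k} (hp : p ∈ linearForms k n) :
    ∃ c : Fin n → k, p = ∑ i, c i • X i := by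
  choose c hc using fun i : Fin n => dirDeriv_eq_C hp (Pi.single i 1)
  refine ⟨c, ?_⟩
  have := sum_X_mul_dirDeriv (m := 1) hp
  simp only [hc, Nat.cast_one, one_smul] at this
  rw [← this]
  exact Finset.sum_congr rfl fun i _ => by rw [smul_eq_C_mul, mul_comm]

theorem X_mem_linearForms (i : Fin n) : (X i : MvPolynomial (Fin n) k) ∈ linearForms k n :=
  isHomogeneous_X k i

theorem dirDeriv_mem_pow {U : Submodule k (MvPolynomial (Fin n) k)} (hU : U ≤ linearForms k n)
    (e : ℕ) (v : Fin n → k) : ∀ h ∈ U ^ (e + 1), dirDeriv v h ∈ U ^ e := by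
  induction e with
  | zero =>
    intro h hh
    rw [zero_add, pow_one] at hh
    obtain ⟨c, hc⟩ := dirDeriv_eq_C (hU hh) v
    rw [hc, pow_zero]
    exact Submodule.mem_one.2 ⟨c, rfl⟩
  | succ e ih =>
    intro h hh
    rw [pow_succ] at hh
    induction hh using Submodule.mul_induction_on' with
    | mem_mul_mem a ha u hu =>
      obtain ⟨c, hc⟩ := dirDeriv_eq_C (hU hu) v
      rw [Derivation.leibniz, hc, smul_eq_mul, smul_eq_mul, mul_comm a, ← smul_eq_C_mul, mul_comm u]
      refine Submodule.add_mem _ (Submodule.smul_mem _ _ ha) ?_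
      rw [pow_succ]
      exact Submodule.mul_mem_mul (ih a ha) hu
    | add x _ y _ hx hy => rw [map_add]; exact Submodule.add_mem _ hx hy

theorem pow_le_homogeneousSubmodule {U : Submodule k (MvPolynomial (Fin n) k)}
    (hU : U ≤ linearForms k n) (e : ℕ) : U ^ e ≤ homogeneousSubmodule (Fin n) k e := by
  induction e with
  | zero =>
    rw [pow_zero]
    intro x hx
    obtain ⟨c, rfl⟩ := Submodule.mem_one.1 hx
    exact isHomogeneous_C (Fin n) c
  | succ e ih =>
    rw [pow_succ, Submodule.mul_le]
    exact fun a ha u hu => IsHomogeneous.mul (ih ha) (hU hu)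

theorem essentialVars_le_of_mem_pow {U : Submodule k (MvPolynomial (Fin n) k)}
    (hU : U ≤ linearForms k n) {d : ℕ} {h : MvPolynomial (Fin n) k} (hh : h ∈ U ^ (d + 1)) :
    essentialVars d h ≤ U := by
  rintro _ ⟨g, hg, rfl⟩
  have := polarPairing_mem (A := fun e => U ^ e) (e := 1) (dirDeriv_mem_pow hU) hg
    (by rwa [add_comm])
  simpa using this

/-- Constant-coefficient operators commute, so every form `g` of degree `d` pairs to zero with
`dirDeriv v h`, itself a form of degree `d`. -/
theorem dirDeriv_eq_zero_of_essentialVars {d : ℕ} (hd : (d.factorial : k) ≠ 0)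
    {h : MvPolynomial (Fin n) k} (hh : h.IsHomogeneous (d + 1)) {v : Fin n → k}
    (hv : ∀ l ∈ essentialVars d h, dirDeriv v l = 0) : dirDeriv v h = 0 := by
  refine eq_zero_of_polarPairing_eq_zero hd (dirDeriv_mem hh v) fun g hg => ?_
  rw [polarPairing_dirDeriv]
  exact hv _ (mem_essentialVars hg)

theorem essentialVars_ne_bot {d : ℕ} (hd : ((d + 1).factorial : k) ≠ 0)
    {h : MvPolynomial (Fin n) k} (hh : h.IsHomogeneous (d + 1)) (h0 : h ≠ 0) :
    essentialVars d h ≠ ⊥ := by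
  intro hb
  rw [Nat.factorial_succ, Nat.cast_mul] at hd
  refine h0 (ext_dirDeriv (left_ne_zero_of_mul hd) hh (isHomogeneous_zero _ _ _) fun v => ?_)
  rw [map_zero]
  refine dirDeriv_eq_zero_of_essentialVars (right_ne_zero_of_mul hd) hh fun l hl => ?_
  rw [hb, Submodule.mem_bot] at hl
  rw [hl, map_zero]

/-! ### Nondegeneracy of smooth forms -/

/-- The partial derivatives of a smooth form are linearly independent. -/
theorem IsSmooth.eq_zero_of_dirDeriv_eq_zero {d : ℕ} (hd : ((d + 1).factorial : k) ≠ 0)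
    (hd0 : d ≠ 0) {f : MvPolynomial (Fin n) k} (hf : f.IsHomogeneous (d + 1)) (hs : IsSmooth f)
    {c : Fin n → k} (hc : dirDeriv c f = 0) : c = 0 := by
  -- Euler's formula at the point `c` reads `m * h(c) = (D_c h)(c)`. It is applied to `f` and to its
  -- partial derivatives, which `D_c` also kills.
  have key : ∀ (m : ℕ) (h : MvPolynomial (Fin n) k), (m : k) ≠ 0 → h.IsHomogeneous m →
      dirDeriv c h = 0 → eval c h = 0 := by
    intro m h hm hh h0
    have h1 := congrArg (eval c) hh.sum_X_mul_pderiv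
    have h2 := congrArg (eval c) h0
    rw [dirDeriv_apply] at h2
    simp only [map_sum, map_mul, eval_X, smul_eval, map_zero, nsmul_eq_mul, map_natCast] at h1 h2
    rw [h2] at h1
    exact (mul_eq_zero.1 h1.symm).resolve_left hm
  have hev : ∀ h : MvPolynomial (Fin n) k,
      aeval (fun i => algebraMap k (AlgebraicClosure k) (c i)) h =
        algebraMap k (AlgebraicClosure k) (eval c h) := by
    intro h
    have := aeval_algebraMap_apply (AlgebraicClosure k) c h
    rwa [aeval_eq_eval] at this
  by_contra hne
  obtain ⟨i, hi⟩ := hs (fun i => algebraMap k (AlgebraicClosure k) (c i))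
    (fun h => hne (funext fun i => by simpa using congrFun h i))
    (by rw [hev, key _ f (natCast_ne_zero_of_factorial hd d.succ_ne_zero le_rfl) hf hc, map_zero])
  refine hi ?_
  rw [hev, key d (pderiv i f) (natCast_ne_zero_of_factorial hd hd0 d.le_succ) ?_ ?_, map_zero]
  · rw [← dirDeriv_single]; exact dirDeriv_mem hf _
  · rw [← dirDeriv_single, dirDeriv_comm, hc, map_zero]

theorem essentialVars_eq_linearForms {d : ℕ} {f : MvPolynomial (Fin n) k}
    (hf : f.IsHomogeneous (d + 1)) (hd : (d.factorial : k) ≠ 0)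
    (hnd : ∀ c : Fin n → k, dirDeriv c f = 0 → c = 0) : essentialVars d f = linearForms k n := by
  refine le_antisymm (essentialVars_le_linearForms hf) fun l hl => ?_
  by_contra hn
  obtain ⟨φ, hφ, hle⟩ := Submodule.exists_le_ker_of_notMem hn
  -- On linear forms, any functional is the derivative in the direction of its values on the
  -- variables. One vanishing on `E(f)` would thus give a direction killing `f`.
  have hD : ∀ p ∈ linearForms k n, dirDeriv (fun i => φ (X i)) p = C (φ p) := by
    intro p hp
    obtain ⟨c, rfl⟩ := exists_eq_sum_X hp
    simp only [map_sum, Derivation.map_smul, dirDeriv_X, map_smul, smul_eq_mul, C_mul]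
    simp only [smul_eq_C_mul]
  have h0 := hnd (fun i => φ (X i)) (dirDeriv_eq_zero_of_essentialVars hd hf fun p hp => by
    rw [hD p (essentialVars_le_linearForms hf hp), LinearMap.mem_ker.1 (hle hp), map_zero])
  have := hD l hl
  rw [h0, map_zero] at this
  exact hφ (C_injective _ _ (by rw [← this, map_zero]; rfl))

/-! ### Self-adjoint operators -/

/-- `R` is self-adjoint for the symmetric multilinear form attached to `f`. -/
def IsSelfAdjointFor (f : MvPolynomial (Fin n) k) (R : Module.End k (Fin n → k)) : Prop :=
  ∀ u v, dirDeriv u (dirDeriv (R v) f) = dirDeriv (R u) (dirDeriv v f)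

theorem IsSelfAdjointFor.mul {f : MvPolynomial (Fin n) k} {R Q : Module.End k (Fin n → k)}
    (hR : IsSelfAdjointFor f R) (hQ : IsSelfAdjointFor f Q) (h : Commute R Q) :
    IsSelfAdjointFor f (R * Q) := by
  intro u v
  conv_rhs => rw [h.eq]
  rw [Module.End.mul_apply, Module.End.mul_apply, hR, hQ]

theorem IsSelfAdjointFor.one (f : MvPolynomial (Fin n) k) : IsSelfAdjointFor f 1 :=
  fun _ _ => rfl

theorem IsSelfAdjointFor.sub {f : MvPolynomial (Fin n) k} {R Q : Module.End k (Fin n → k)}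
    (hR : IsSelfAdjointFor f R) (hQ : IsSelfAdjointFor f Q) : IsSelfAdjointFor f (R - Q) := by
  intro u v
  simp only [LinearMap.sub_apply, map_sub, Derivation.sub_apply, hR u v, hQ u v]

/-- Self-adjoint operators of a nondegenerate form of degree at least three commute. -/
theorem IsSelfAdjointFor.commute {d : ℕ} (hd : 2 ≤ d) (hfac : ((d + 1).factorial : k) ≠ 0)
    {f : MvPolynomial (Fin n) k} (hf : f.IsHomogeneous (d + 1))
    (hnd : ∀ c : Fin n → k, dirDeriv c f = 0 → c = 0) {P Q : Module.End k (Fin n → k)}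
    (hP : IsSelfAdjointFor f P) (hQ : IsSelfAdjointFor f Q) : Commute P Q := by
  obtain ⟨e, rfl⟩ := Nat.exists_eq_add_of_le' hd
  refine LinearMap.ext fun v => sub_eq_zero.1 (hnd _ ?_)
  rw [map_sub, Derivation.sub_apply, sub_eq_zero]
  refine ext_dirDeriv (m := e + 2) (natCast_ne_zero_of_factorial hfac (by omega) (by omega))
    (dirDeriv_mem hf _) (dirDeriv_mem hf _) fun u => ?_
  refine ext_dirDeriv (m := e + 1) (natCast_ne_zero_of_factorial hfac (by omega) (by omega))
    (dirDeriv_mem (dirDeriv_mem hf _) _) (dirDeriv_mem (dirDeriv_mem hf _) _) fun w => ?_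
  -- With three slots `w, u, v`, move `P` from `v` to `u`, then `Q` from `v` to `w`, and bring them
  -- back to `v` in the opposite order.
  rw [Module.End.mul_apply, Module.End.mul_apply, hP u, dirDeriv_comm w, hQ w, dirDeriv_comm (P u),
    ← hP u, dirDeriv_comm (Q w), ← hQ w, dirDeriv_comm u]

/-! ### Transposes and the forms attached to self-adjoint operators -/

/-- On linear forms, this is the transpose of `R`. -/
def pullback (R : Module.End k (Fin n → k)) :
    MvPolynomial (Fin n) k →ₗ[k] MvPolynomial (Fin n) k :=
  ∑ i, LinearMap.mulLeft k (X i) ∘ₗ (dirDeriv (R (Pi.single i 1))).toLinearMap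

theorem pullback_apply (R : Module.End k (Fin n → k)) (p : MvPolynomial (Fin n) k) :
    pullback R p = ∑ i, X i * dirDeriv (R (Pi.single i 1)) p := by
  simp [pullback]

theorem pullback_add (R Q : Module.End k (Fin n → k)) (p : MvPolynomial (Fin n) k) :
    pullback (R + Q) p = pullback R p + pullback Q p := by
  simp [pullback_apply, mul_add, Finset.sum_add_distrib]

theorem sum_smul_dirDeriv_single (R : Module.End k (Fin n → k)) (v : Fin n → k)
    (p : MvPolynomial (Fin n) k) :
    ∑ i, v i • dirDeriv (R (Pi.single i 1)) p = dirDeriv (R v) p := by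
  have hv : v = ∑ i, v i • Pi.single i (1 : k) := by
    ext j; simp [Pi.single_apply]
  conv_rhs => rw [hv]
  rw [map_sum, map_sum, ← Derivation.coeFnAddMonoidHom_apply, map_sum, Finset.sum_apply]
  simp

theorem dirDeriv_pullback (R : Module.End k (Fin n → k)) (v : Fin n → k)
    (p : MvPolynomial (Fin n) k) : dirDeriv v (pullback R p) =
      dirDeriv (R v) p + ∑ i, X i * dirDeriv v (dirDeriv (R (Pi.single i 1)) p) := by
  rw [pullback_apply, map_sum, ← sum_smul_dirDeriv_single R v, ← Finset.sum_add_distrib]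
  refine Finset.sum_congr rfl fun i _ => ?_
  rw [Derivation.leibniz, dirDeriv_X, smul_eq_mul, smul_eq_mul, smul_eq_C_mul]
  ring

theorem isHomogeneous_pullback (R : Module.End k (Fin n → k)) {m : ℕ}
    {p : MvPolynomial (Fin n) k} (hp : p.IsHomogeneous (m + 1)) :
    (pullback R p).IsHomogeneous (m + 1) := by
  rw [pullback_apply]
  refine IsHomogeneous.sum _ _ _ fun i _ => ?_
  rw [add_comm]
  exact (isHomogeneous_X _ _).mul (dirDeriv_mem hp _)

theorem pullback_mem_linearForms (R : Module.End k (Fin n → k)) {l : MvPolynomial (Fin n) k}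
    (hl : l ∈ linearForms k n) : pullback R l ∈ linearForms k n :=
  isHomogeneous_pullback (m := 0) R hl

theorem dirDeriv_pullback_linearForms (R : Module.End k (Fin n → k)) (v : Fin n → k)
    {l : MvPolynomial (Fin n) k} (hl : l ∈ linearForms k n) :
    dirDeriv v (pullback R l) = dirDeriv (R v) l := by
  simp [dirDeriv_pullback, dirDeriv_dirDeriv_linearForms hl]

theorem ext_linearForms {l l' : MvPolynomial (Fin n) k} (hl : l ∈ linearForms k n)
    (hl' : l' ∈ linearForms k n) (h : ∀ v, dirDeriv v l = dirDeriv v l') : l = l' :=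
  ext_dirDeriv (m := 1) (by simp) hl hl' h

/-- The form whose derivative in direction `v` is the derivative of `f` in direction `R v`. -/
def potential (d : ℕ) (f : MvPolynomial (Fin n) k) (R : Module.End k (Fin n → k)) :
    MvPolynomial (Fin n) k :=
  ((d + 1 : ℕ) : k)⁻¹ • pullback R f

theorem isHomogeneous_potential {d : ℕ} {f : MvPolynomial (Fin n) k}
    (hf : f.IsHomogeneous (d + 1)) (R : Module.End k (Fin n → k)) :
    (potential d f R).IsHomogeneous (d + 1) :=
  Submodule.smul_mem (homogeneousSubmodule (Fin n) k (d + 1)) _ (isHomogeneous_pullback R hf)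

theorem potential_add (d : ℕ) (f : MvPolynomial (Fin n) k) (R Q : Module.End k (Fin n → k)) :
    potential d f (R + Q) = potential d f R + potential d f Q := by
  rw [potential, pullback_add, smul_add, potential, potential]

/-- Differentiating `pullback R f` gives `D_{R v} f` plus, by self-adjointness, the Euler sum of
`D_{R v} f`, which contributes `d` further copies. -/
theorem dirDeriv_potential {d : ℕ} (hd : ((d + 1 : ℕ) : k) ≠ 0) {f : MvPolynomial (Fin n) k}
    (hf : f.IsHomogeneous (d + 1)) {R : Module.End k (Fin n → k)} (hR : IsSelfAdjointFor f R)
    (v : Fin n → k) : dirDeriv v (potential d f R) = dirDeriv (R v) f := by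
  rw [potential, Derivation.map_smul, dirDeriv_pullback, inv_smul_eq_iff₀ hd]
  simp_rw [hR v, dirDeriv_comm (R v)]
  rw [sum_X_mul_dirDeriv (dirDeriv_mem hf _), Nat.cast_succ, add_smul, one_smul, add_comm]

theorem essentialVars_potential {d : ℕ} (hd : ((d + 1 : ℕ) : k) ≠ 0)
    {f : MvPolynomial (Fin n) k} (hf : f.IsHomogeneous (d + 1))
    (hE : essentialVars d f = linearForms k n) {R : Module.End k (Fin n → k)}
    (hR : IsSelfAdjointFor f R) :
    essentialVars d (potential d f R) = (linearForms k n).map (pullback R) := by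
  rw [← hE, essentialVars, essentialVars, ← Submodule.map_comp]
  refine SetLike.coe_injective ?_
  rw [Submodule.map_coe, Submodule.map_coe]
  refine Set.image_congr fun g hg => ?_
  have hgf : polarPairing g f ∈ linearForms k n :=
    essentialVars_le_linearForms hf (mem_essentialVars hg)
  rw [LinearMap.comp_apply, LinearMap.flip_apply, LinearMap.flip_apply]
  refine ext_linearForms (essentialVars_le_linearForms (isHomogeneous_potential hf R)
    (mem_essentialVars hg)) (pullback_mem_linearForms R hgf) fun v => ?_
  rw [dirDeriv_pullback_linearForms R v hgf, ← polarPairing_dirDeriv, ← polarPairing_dirDeriv,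
    dirDeriv_potential hd hf hR]

theorem pullback_X (R : Module.End k (Fin n → k)) (j : Fin n) :
    pullback R (X j) = ∑ i, R (Pi.single i 1) j • X i := by
  rw [pullback_apply]
  exact Finset.sum_congr rfl fun i _ => by rw [dirDeriv_X, smul_eq_C_mul, mul_comm]

/-- Replacing `D_i h` by its equal `D_{R e_i} h` in Euler's formula turns the factors `X i` into
transposed variables `pullback R (X j)`; the coefficients `D_j h` satisfy the same hypothesis. -/
theorem mem_map_pullback_pow {m : ℕ} (hm : (m.factorial : k) ≠ 0) {R : Module.End k (Fin n → k)}
    {h : MvPolynomial (Fin n) k} (hh : h.IsHomogeneous m)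
    (hR : ∀ v, dirDeriv (R v) h = dirDeriv v h) :
    h ∈ ((linearForms k n).map (pullback R)) ^ m := by
  induction m generalizing h with
  | zero =>
    rw [pow_zero, Submodule.mem_one]
    exact ⟨_, (totalDegree_eq_zero_iff_eq_C.1 (Nat.le_zero.1 hh.totalDegree_le)).symm⟩
  | succ m ih =>
    have hm1 : ((m + 1 : ℕ) : k) ≠ 0 := natCast_ne_zero_of_factorial hm m.succ_ne_zero le_rfl
    have hm0 : (m.factorial : k) ≠ 0 := by
      rw [Nat.factorial_succ, Nat.cast_mul] at hm
      exact right_ne_zero_of_mul hm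
    have key : ((m + 1 : ℕ) : k) • h =
        ∑ j, dirDeriv (Pi.single j 1) h * pullback R (X j) := by
      rw [← sum_X_mul_dirDeriv hh]
      simp_rw [pullback_X, Finset.mul_sum]
      rw [Finset.sum_comm]
      refine Finset.sum_congr rfl fun i _ => ?_
      rw [← hR, dirDeriv_apply, Finset.mul_sum]
      refine Finset.sum_congr rfl fun j _ => ?_
      rw [dirDeriv_single, mul_smul_comm, mul_smul_comm, mul_comm]
    rw [← inv_smul_smul₀ hm1 h, key]
    refine Submodule.smul_mem _ _ (Submodule.sum_mem _ fun j _ => ?_)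
    rw [pow_succ]
    refine Submodule.mul_mem_mul (ih hm0 (dirDeriv_mem hh _) fun v => ?_)
      (Submodule.mem_map_of_mem (X_mem_linearForms j))
    rw [dirDeriv_comm, hR, dirDeriv_comm]

/-- A sum of two orthogonal nonzero self-adjoint idempotents splits the corresponding form. -/
theorem isDirectSumIn_potential {d : ℕ} (hfac : ((d + 1).factorial : k) ≠ 0)
    {f : MvPolynomial (Fin n) k} (hf : f.IsHomogeneous (d + 1))
    (hnd : ∀ c : Fin n → k, dirDeriv c f = 0 → c = 0) {R Q : Module.End k (Fin n → k)}
    (hR : IsSelfAdjointFor f R) (hQ : IsSelfAdjointFor f Q) (hRR : R * R = R) (hQQ : Q * Q = Q)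
    (hRQ : R * Q = 0) (hQR : Q * R = 0) (hR0 : R ≠ 0) (hQ0 : Q ≠ 0)
    {g : MvPolynomial (Fin n) k} (hg : g.IsHomogeneous (d + 1))
    (hgD : ∀ v, dirDeriv v g = dirDeriv ((R + Q) v) f) :
    IsDirectSumIn d (essentialVars d g) g := by
  have hd : ((d + 1 : ℕ) : k) ≠ 0 := natCast_ne_zero_of_factorial hfac d.succ_ne_zero le_rfl
  have hdfac : (d.factorial : k) ≠ 0 := by
    rw [Nat.factorial_succ, Nat.cast_mul] at hfac
    exact right_ne_zero_of_mul hfac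
  have hS : IsSelfAdjointFor f (R + Q) := by
    intro u v
    simp only [LinearMap.add_apply, map_add, Derivation.add_apply, hR u v, hQ u v]
  obtain rfl : g = potential d f (R + Q) :=
    ext_dirDeriv hd hg (isHomogeneous_potential hf _) fun v => by
      rw [hgD, dirDeriv_potential hd hf hS]
  have hE := essentialVars_eq_linearForms hf hdfac hnd
  have mem : ∀ {A : Module.End k (Fin n → k)}, IsSelfAdjointFor f A → A * A = A →
      potential d f A ∈ ((linearForms k n).map (pullback A)) ^ (d + 1) := by
    intro A hA hAA
    refine mem_map_pullback_pow hfac (isHomogeneous_potential hf A) fun v => ?_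
    rw [dirDeriv_potential hd hf hA, dirDeriv_potential hd hf hA, ← Module.End.mul_apply, hAA]
  have ne : ∀ {A : Module.End k (Fin n → k)}, IsSelfAdjointFor f A → A ≠ 0 →
      potential d f A ≠ 0 := by
    intro A hA hA0 h0
    refine hA0 (LinearMap.ext fun v => hnd _ ?_)
    rw [← dirDeriv_potential hd hf hA, h0, map_zero]
  have absorb : ∀ {A B : Module.End k (Fin n → k)}, A * B = A → ∀ l ∈ linearForms k n,
      pullback B (pullback A l) = pullback A l := by
    intro A B hAB l hl
    have hl' := pullback_mem_linearForms A hl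
    refine ext_linearForms (pullback_mem_linearForms B hl') hl' fun v => ?_
    rw [dirDeriv_pullback_linearForms _ _ hl', dirDeriv_pullback_linearForms _ _ hl,
      dirDeriv_pullback_linearForms _ _ hl, ← Module.End.mul_apply, hAB]
  -- The two subspaces are the images of `V` under the transposes of `R` and `Q`.
  refine ⟨_, _, ?_, ?_, _, mem hR hRR, _, mem hQ hQQ, ne hR hR0, ne hQ hQ0, potential_add _ _ _ _⟩
  · rw [Submodule.disjoint_def]
    rintro _ ⟨l, hl, rfl⟩ ⟨l', hl', h⟩
    rw [← absorb hRR l hl, ← h]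
    have hm := pullback_mem_linearForms Q hl'
    refine ext_linearForms (pullback_mem_linearForms R hm) (Submodule.zero_mem _) fun v => ?_
    rw [dirDeriv_pullback_linearForms _ _ hm, dirDeriv_pullback_linearForms _ _ hl',
      ← Module.End.mul_apply, hQR]
    simp
  · rw [essentialVars_potential hd hf hE hS]
    refine le_antisymm (sup_le ?_ ?_) ?_
    · rintro _ ⟨l, hl, rfl⟩
      exact ⟨_, pullback_mem_linearForms R hl, absorb (by rw [mul_add, hRR, hRQ, add_zero]) l hl⟩
    · rintro _ ⟨l, hl, rfl⟩
      exact ⟨_, pullback_mem_linearForms Q hl, absorb (by rw [mul_add, hQQ, hQR, zero_add]) l hl⟩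
    · rintro _ ⟨l, hl, rfl⟩
      rw [pullback_add]
      exact Submodule.add_mem_sup (Submodule.mem_map_of_mem hl) (Submodule.mem_map_of_mem hl)

/-! ### Independent families of subspaces -/

theorem iSupIndep_iff_sum_eq_zero {ι N : Type*} [Fintype ι] [AddCommGroup N] [Module k N]
    (p : ι → Submodule k N) : iSupIndep p ↔
      ∀ v : ι → N, (∀ i, v i ∈ p i) → ∑ i, v i = 0 → ∀ i, v i = 0 := by
  classical
  rw [iSupIndep_iff_finsetSum_eq_zero_imp_eq_zero]
  refine ⟨fun h v hv h0 i => h Finset.univ v (fun i _ => hv i) h0 i (Finset.mem_univ i),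
    fun h s v hv h0 i hi => ?_⟩
  have := h (fun i => if i ∈ s then v i else 0)
    (fun i => by
      split_ifs with hi
      · exact hv i hi
      · exact Submodule.zero_mem _)
    (by simpa using h0) i
  simpa [hi] using this

theorem exists_sum_eq_of_mem_iSup {ι N : Type*} [Fintype ι] [AddCommGroup N] [Module k N]
    {p : ι → Submodule k N} {x : N} (hx : x ∈ ⨆ i, p i) :
    ∃ v : ι → N, (∀ i, v i ∈ p i) ∧ ∑ i, v i = x := by
  obtain ⟨f, hf, rfl⟩ := (Submodule.mem_iSup_iff_exists_finsupp _ _).1 hx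
  exact ⟨f, hf, by rw [Finsupp.sum_fintype _ _ fun _ => rfl]⟩

theorem iSupIndep_cons_update {N : Type*} [AddCommGroup N] [Module k N] {r : ℕ}
    {p : Fin r → Submodule k N} (hp : iSupIndep p) (i : Fin r) {U W : Submodule k N}
    (hUW : Disjoint U W) (hi : U ⊔ W = p i) :
    iSupIndep (Fin.cons U (Function.update p i W) : Fin (r + 1) → Submodule k N) := by
  rw [iSupIndep_iff_sum_eq_zero] at hp ⊢
  intro v hv h0
  have hv0 : v 0 ∈ U := hv 0
  have hvs : ∀ j : Fin r, v j.succ ∈ Function.update p i W j := fun j => hv j.succ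
  have hvi : v i.succ ∈ W := by simpa using hvs i
  rw [Fin.sum_univ_succ] at h0
  -- Merging the `U` part `v 0` into slot `i` gives a vanishing sum for the original family.
  have h := hp (fun j => v j.succ + if j = i then v 0 else 0) (fun j => ?_) ?_
  · have h1 := h i
    simp only [if_true] at h1
    have h2 : v 0 = 0 := Submodule.disjoint_def.1 hUW _ hv0 (by
      rw [← neg_eq_of_add_eq_zero_right h1]
      exact Submodule.neg_mem _ hvi)
    intro j
    refine Fin.cases h2 (fun j => ?_) j
    simpa [h2] using h j
  · by_cases hj : j = i
    · subst hj
      rw [if_pos rfl, ← hi, add_comm]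
      exact Submodule.add_mem_sup hv0 hvi
    · simpa [hj] using hvs j
  · rw [Finset.sum_add_distrib, Finset.sum_ite_eq' Finset.univ i]
    simpa [add_comm] using h0

theorem iSup_cons_update {α : Type*} [CompleteLattice α] {r : ℕ} {p : Fin r → α} (i : Fin r)
    {U W : α} (hi : U ⊔ W = p i) :
    (⨆ j, (Fin.cons U (Function.update p i W) : Fin (r + 1) → α) j) = ⨆ j, p j := by
  refine le_antisymm (iSup_le fun j => ?_) (iSup_le fun j => ?_)
  · refine Fin.cases ?_ (fun j => ?_) j
    · exact (le_sup_left.trans hi.le).trans (le_iSup p i)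
    · rw [Fin.cons_succ]
      by_cases hj : j = i
      · subst hj
        rw [Function.update_self]
        exact (le_sup_right.trans hi.le).trans (le_iSup p j)
      · rw [Function.update_of_ne hj]
        exact le_iSup p j
  · by_cases hj : j = i
    · subst hj
      rw [← hi]
      refine sup_le ?_ ?_
      · exact le_iSup (Fin.cons U (Function.update p j W) : Fin (r + 1) → α) 0
      · refine le_trans ?_
          (le_iSup (Fin.cons U (Function.update p j W) : Fin (r + 1) → α) j.succ)
        simp
    · refine le_trans ?_
        (le_iSup (Fin.cons U (Function.update p i W) : Fin (r + 1) → α) j.succ)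
      simp [hj]

/-! ### Refinement and existence -/

/-- A decomposition of `f` into nonzero forms in independent sets of variables, exhausting all
linear forms. -/
structure IsDecomposition (d : ℕ) (f : MvPolynomial (Fin n) k) {r : ℕ}
    (F : Fin r → MvPolynomial (Fin n) k) : Prop where
  isHomogeneous : ∀ i, (F i).IsHomogeneous (d + 1)
  ne_zero : ∀ i, F i ≠ 0
  sum_eq : f = ∑ i, F i
  independent : iSupIndep fun i => essentialVars d (F i)
  iSup_eq : ⨆ i, essentialVars d (F i) = linearForms k n

theorem IsMaximallyFine.isDecomposition {d : ℕ} {f : MvPolynomial (Fin n) k} {r : ℕ}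
    {F : Fin r → MvPolynomial (Fin n) k} (hF : IsMaximallyFine d f F) : IsDecomposition d f F :=
  ⟨hF.isHomogeneous, hF.ne_zero, hF.sum_eq, hF.independent, hF.iSup_eq⟩

/-- Each `E(F i)` is nonzero; picking a nonzero vector in each gives `r` independent linear forms in
the span of `n` variables. -/
theorem IsDecomposition.card_le {d : ℕ} (hfac : ((d + 1).factorial : k) ≠ 0)
    {f : MvPolynomial (Fin n) k} {r : ℕ} {F : Fin r → MvPolynomial (Fin n) k}
    (hF : IsDecomposition d f F) : r ≤ n := by
  classical
  choose v hv hv0 using fun i => Submodule.exists_mem_ne_zero_of_ne_bot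
    (essentialVars_ne_bot hfac (hF.isHomogeneous i) (hF.ne_zero i))
  have hli := hF.independent.linearIndependent _ hv hv0
  have := linearIndependent_le_span' v hli
    ((Finset.univ.image (X : Fin n → MvPolynomial (Fin n) k) : Finset _) : Set _) (by
      rintro _ ⟨i, rfl⟩
      obtain ⟨c, hc⟩ := exists_eq_sum_X
        (essentialVars_le_linearForms (hF.isHomogeneous i) (hv i))
      rw [hc]
      exact Submodule.sum_mem _ fun j _ => Submodule.smul_mem _ _
        (Submodule.subset_span (by simp)))
  rw [Cardinal.mk_fin, Nat.cast_le] at this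
  exact this.trans ((Fintype.card_coe _).le.trans (Finset.card_image_le.trans (by simp)))

theorem IsDirectSumIn.exists_essentialVars {d : ℕ} {g : MvPolynomial (Fin n) k}
    (hg : g.IsHomogeneous (d + 1)) (h : IsDirectSumIn d (essentialVars d g) g) :
    ∃ g₁ g₂ : MvPolynomial (Fin n) k, g₁.IsHomogeneous (d + 1) ∧ g₂.IsHomogeneous (d + 1) ∧
      g₁ ≠ 0 ∧ g₂ ≠ 0 ∧ g = g₁ + g₂ ∧ Disjoint (essentialVars d g₁) (essentialVars d g₂) ∧
      essentialVars d g₁ ⊔ essentialVars d g₂ = essentialVars d g := by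
  obtain ⟨U, W, hUW, hsup, g₁, h₁, g₂, h₂, h₁0, h₂0, hgg⟩ := h
  have hE := essentialVars_le_linearForms hg
  have hU : U ≤ linearForms k n := le_trans (hsup ▸ le_sup_left) hE
  have hW : W ≤ linearForms k n := le_trans (hsup ▸ le_sup_right) hE
  have hE₁ := essentialVars_le_of_mem_pow hU h₁
  have hE₂ := essentialVars_le_of_mem_pow hW h₂
  refine ⟨g₁, g₂, pow_le_homogeneousSubmodule hU _ h₁, pow_le_homogeneousSubmodule hW _ h₂,
    h₁0, h₂0, hgg, hUW.mono hE₁ hE₂, le_antisymm (hsup ▸ sup_le_sup hE₁ hE₂) ?_⟩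
  rintro _ ⟨q, hq, rfl⟩
  rw [LinearMap.flip_apply, hgg, map_add]
  exact Submodule.add_mem_sup (mem_essentialVars hq) (mem_essentialVars hq)

theorem IsDecomposition.exists_succ {d : ℕ} {f : MvPolynomial (Fin n) k} {r : ℕ}
    {F : Fin r → MvPolynomial (Fin n) k} (hF : IsDecomposition d f F) (i : Fin r)
    (hi : IsDirectSumIn d (essentialVars d (F i)) (F i)) :
    ∃ G : Fin (r + 1) → MvPolynomial (Fin n) k, IsDecomposition d f G := by
  obtain ⟨g₁, g₂, hh₁, hh₂, h₁0, h₂0, hgg, hdis, hsup⟩ :=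
    hi.exists_essentialVars (hF.isHomogeneous i)
  have hcomp : (fun j => essentialVars d
      ((Fin.cons g₁ (Function.update F i g₂) : Fin (r + 1) → MvPolynomial (Fin n) k) j)) =
      Fin.cons (essentialVars d g₁)
        (Function.update (fun j => essentialVars d (F j)) i (essentialVars d g₂)) := by
    funext j
    refine Fin.cases rfl (fun j => ?_) j
    by_cases hj : j = i
    · subst hj; simp
    · simp [hj]
  refine ⟨Fin.cons g₁ (Function.update F i g₂), fun j => ?_, fun j => ?_, ?_, ?_, ?_⟩
  · refine Fin.cases hh₁ (fun j => ?_) j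
    by_cases hj : j = i
    · subst hj; simpa using hh₂
    · simpa [hj] using hF.isHomogeneous j
  · refine Fin.cases h₁0 (fun j => ?_) j
    by_cases hj : j = i
    · subst hj; simpa using h₂0
    · simpa [hj] using hF.ne_zero j
  · rw [Fin.sum_univ_succ, Fin.cons_zero]
    simp only [Fin.cons_succ]
    rw [Finset.sum_update_of_mem (Finset.mem_univ i), ← add_assoc, ← hgg, hF.sum_eq,
      Finset.sdiff_singleton_eq_erase, Finset.add_sum_erase _ _ (Finset.mem_univ i)]
  · rw [hcomp]
    exact iSupIndep_cons_update hF.independent i hdis hsup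
  · rw [hcomp, iSup_cons_update i hsup, hF.iSup_eq]

theorem IsDecomposition.exists_isMaximallyFine {d : ℕ} (hfac : ((d + 1).factorial : k) ≠ 0)
    {f : MvPolynomial (Fin n) k} {r : ℕ} {F : Fin r → MvPolynomial (Fin n) k}
    (hF : IsDecomposition d f F) :
    ∃ (s : ℕ) (G : Fin s → MvPolynomial (Fin n) k), IsMaximallyFine d f G := by
  -- Subtraction is truncated: the value zero means `n ≤ r`, and one more splitting would violate
  -- `card_le`.
  induction hm : n - r generalizing r with
  | zero =>
    refine ⟨r, F, hF.isHomogeneous, hF.ne_zero, hF.sum_eq, hF.independent, hF.iSup_eq,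
      fun i hi => ?_⟩
    obtain ⟨G, hG⟩ := hF.exists_succ i hi
    have := hG.card_le hfac
    omega
  | succ m ih =>
    by_cases h : ∃ i, IsDirectSumIn d (essentialVars d (F i)) (F i)
    · obtain ⟨i, hi⟩ := h
      obtain ⟨G, hG⟩ := hF.exists_succ i hi
      exact ih hG (by omega)
    · exact ⟨r, F, hF.isHomogeneous, hF.ne_zero, hF.sum_eq, hF.independent, hF.iSup_eq,
        fun i hi => h ⟨i, hi⟩⟩

theorem isDecomposition_singleton {d : ℕ} {f : MvPolynomial (Fin n) k}
    (hf : f.IsHomogeneous (d + 1)) (hf0 : f ≠ 0) (hE : essentialVars d f = linearForms k n) :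
    IsDecomposition d f (fun _ : Fin 1 => f) where
  isHomogeneous _ := hf
  ne_zero _ := hf0
  sum_eq := by simp
  independent := iSupIndep_subsingleton _
  iSup_eq := by rw [ciSup_const, hE]

/-! ### Idempotents and uniqueness -/

/-- A decomposition of `f` comes from a complete family of orthogonal idempotents. -/
theorem IsDecomposition.exists_idempotents {d : ℕ} (hfac : (d.factorial : k) ≠ 0)
    {f : MvPolynomial (Fin n) k} {r : ℕ} {F : Fin r → MvPolynomial (Fin n) k}
    (hF : IsDecomposition d f F) :
    ∃ P : Fin r → Module.End k (Fin n → k), CompleteOrthogonalIdempotents P ∧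
      ∀ a v, dirDeriv v (F a) = dirDeriv (P a v) f := by
  have hind := (iSupIndep_iff_sum_eq_zero _).1 hF.independent
  have hX : ∀ j : Fin n, (X j : MvPolynomial (Fin n) k) ∈ ⨆ a, essentialVars d (F a) :=
    fun j => hF.iSup_eq ▸ X_mem_linearForms j
  choose e he hsum using fun j => exists_sum_eq_of_mem_iSup (hX j)
  have hle : ∀ a, essentialVars d (F a) ≤ linearForms k n :=
    fun a => essentialVars_le_linearForms (hF.isHomogeneous a)
  -- Here `e j a` is the component of `X j` in `E(F a)`, so `P a` is the transpose of the projection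
  -- of `V` onto `E(F a)`.
  let P : Fin r → Module.End k (Fin n → k) := fun a =>
    { toFun := fun v j => constantCoeff (dirDeriv v (e j a))
      map_add' := fun v w => by ext j; simp
      map_smul' := fun c v => by ext j; simp [smul_eq_C_mul] }
  have hP : ∀ a v j, C (P a v j) = dirDeriv v (e j a) := by
    intro a v j
    obtain ⟨c, hc⟩ := dirDeriv_eq_C (hle a (he j a)) v
    change C (constantCoeff (dirDeriv v (e j a))) = _
    rw [hc, constantCoeff_C]
  have key : ∀ a b v, ∀ l ∈ essentialVars d (F b),
      dirDeriv (P a v) l = if a = b then dirDeriv v l else 0 := by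
    intro a b v l hl
    obtain ⟨c, hc⟩ := exists_eq_sum_X (hle b hl)
    -- Both terms are the `a`-component of `l`, which lies in `E(F b)`; independence makes
    -- components unique.
    have h1 : ∀ a, (∑ j, c j • e j a) - (if a = b then l else 0) = 0 := by
      refine hind _ (fun a => ?_) ?_
      · refine Submodule.sub_mem _ (Submodule.sum_mem _ fun j _ =>
          Submodule.smul_mem _ _ (he j a)) ?_
        split_ifs with hab
        · exact hab ▸ hl
        · exact Submodule.zero_mem _
      · rw [Finset.sum_sub_distrib, Finset.sum_comm]
        simp_rw [← Finset.smul_sum, hsum]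
        rw [← hc]
        simp
    have h2 := congrArg (dirDeriv v) (sub_eq_zero.1 (h1 a))
    rw [map_sum] at h2
    simp_rw [Derivation.map_smul, ← hP] at h2
    rw [apply_ite (dirDeriv v), map_zero] at h2
    rw [← h2, hc, map_sum]
    simp_rw [Derivation.map_smul, dirDeriv_X]
  have key' : ∀ a b v, dirDeriv (P a v) (F b) = if a = b then dirDeriv v (F b) else 0 := by
    intro a b v
    have hF' := hF.isHomogeneous b
    by_cases hab : a = b
    · rw [if_pos hab, ← sub_eq_zero, ← Derivation.sub_apply, ← map_sub]
      refine dirDeriv_eq_zero_of_essentialVars hfac hF' fun l hl => ?_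
      rw [map_sub, Derivation.sub_apply, key a b v l hl, if_pos hab, sub_self]
    · rw [if_neg hab]
      refine dirDeriv_eq_zero_of_essentialVars hfac hF' fun l hl => ?_
      rw [key a b v l hl, if_neg hab]
  have hmul : ∀ a b, P a * P b = if a = b then P a else 0 := by
    intro a b
    refine LinearMap.ext fun v => funext fun j => C_injective (Fin n) k ?_
    rw [Module.End.mul_apply, hP, key b a v _ (he j a)]
    by_cases hab : a = b
    · rw [if_pos hab, if_pos hab.symm, hP]
    · rw [if_neg hab, if_neg (Ne.symm hab)]
      simp
  refine ⟨P, ⟨⟨fun a => ?_, fun a b hab => ?_⟩, ?_⟩, fun a v => ?_⟩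
  · rw [IsIdempotentElem, hmul, if_pos rfl]
  · change P a * P b = 0
    rw [hmul, if_neg hab]
  · refine LinearMap.ext fun v => funext fun j => C_injective (Fin n) k ?_
    rw [LinearMap.sum_apply, Finset.sum_apply, map_sum]
    simp_rw [hP]
    rw [← map_sum, hsum, dirDeriv_X, Module.End.one_apply]
  · conv_rhs => rw [hF.sum_eq, map_sum]
    simp_rw [key']
    simp

/-- Both sides are second derivatives of `g`, which are symmetric. -/
theorem isSelfAdjointFor_of_dirDeriv_eq {f g : MvPolynomial (Fin n) k}
    {R : Module.End k (Fin n → k)} (h : ∀ v, dirDeriv v g = dirDeriv (R v) f) :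
    IsSelfAdjointFor f R := fun u v => by
  rw [← h, dirDeriv_comm, h, dirDeriv_comm]

/-- An idempotent attached to a form which is not a direct sum cannot be split. -/
theorem mul_eq_zero_or_eq_of_not_isDirectSumIn {d : ℕ} (hd : 2 ≤ d)
    (hfac : ((d + 1).factorial : k) ≠ 0) {f : MvPolynomial (Fin n) k}
    (hf : f.IsHomogeneous (d + 1)) (hnd : ∀ c : Fin n → k, dirDeriv c f = 0 → c = 0)
    {P Q : Module.End k (Fin n → k)} (hQ : IsSelfAdjointFor f Q)
    (hPP : IsIdempotentElem P) (hQQ : IsIdempotentElem Q) {g : MvPolynomial (Fin n) k}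
    (hg : g.IsHomogeneous (d + 1)) (hgD : ∀ v, dirDeriv v g = dirDeriv (P v) f)
    (hn : ¬ IsDirectSumIn d (essentialVars d g) g) : P * Q = 0 ∨ P * Q = P := by
  by_contra! h
  have hP := isSelfAdjointFor_of_dirDeriv_eq hgD
  have hPQ : Commute P Q := hP.commute hd hfac hf hnd hQ
  have hPQ' : Commute P (1 - Q) := (Commute.one_right P).sub_right hPQ
  have hQ0 : Q * (1 - Q) = 0 := hQQ.mul_one_sub_self
  have hQ0' : (1 - Q) * Q = 0 := hQQ.one_sub_mul_self
  have hc : Commute Q (1 - Q) := hQ0.trans hQ0'.symm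
  -- Otherwise `P = P * Q + P * (1 - Q)` is a splitting into nonzero orthogonal self-adjoint
  -- idempotents.
  refine hn (isDirectSumIn_potential hfac hf hnd (R := P * Q) (Q := P * (1 - Q))
    (hP.mul hQ hPQ) (hP.mul ((IsSelfAdjointFor.one f).sub hQ) hPQ') (hPP.mul_of_commute hPQ hQQ)
    (hPP.mul_of_commute hPQ' hQQ.one_sub) ?_ ?_ h.1 ?_ hg ?_)
  · rw [hPQ.eq, mul_assoc, ← mul_assoc P P, hPP.eq, hPQ'.eq, ← mul_assoc, hQ0, zero_mul]
  · rw [hPQ'.eq, mul_assoc, ← mul_assoc P P, hPP.eq, hPQ.eq, ← mul_assoc, hQ0', zero_mul]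
  · rw [mul_sub, mul_one]
    exact fun h0 => h.2 (sub_eq_zero.1 h0).symm
  · rwa [← mul_add, add_sub_cancel, mul_one]

/-- As the `Q j` sum to `1`, some `P i * Q j` is nonzero; indecomposability on both sides then gives
`P i = P i * Q j = Q j * P i = Q j`. -/
theorem IsMaximallyFine.exists_eq {d : ℕ} (hd : 2 ≤ d)
    (hfac : ((d + 1).factorial : k) ≠ 0) {f : MvPolynomial (Fin n) k}
    (hf : f.IsHomogeneous (d + 1)) (hnd : ∀ c : Fin n → k, dirDeriv c f = 0 → c = 0) {r s : ℕ}
    {F : Fin r → MvPolynomial (Fin n) k} {G : Fin s → MvPolynomial (Fin n) k}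
    (hF : IsMaximallyFine d f F) (hG : IsMaximallyFine d f G) (i : Fin r) : ∃ j, F i = G j := by
  have hd1 : ((d + 1 : ℕ) : k) ≠ 0 := natCast_ne_zero_of_factorial hfac d.succ_ne_zero le_rfl
  have hdfac : (d.factorial : k) ≠ 0 := by
    rw [Nat.factorial_succ, Nat.cast_mul] at hfac
    exact right_ne_zero_of_mul hfac
  obtain ⟨P, hP, hPF⟩ := hF.isDecomposition.exists_idempotents hdfac
  obtain ⟨Q, hQ, hQG⟩ := hG.isDecomposition.exists_idempotents hdfac
  have hP0 : P i ≠ 0 := by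
    intro h0
    refine hF.ne_zero i (ext_dirDeriv hd1 (hF.isHomogeneous i) (isHomogeneous_zero _ _ _)
      fun v => ?_)
    rw [hPF, h0]
    simp
  have hex : ∃ j, P i * Q j ≠ 0 := by
    by_contra! h
    refine hP0 ?_
    rw [← mul_one (P i), ← hQ.complete, Finset.mul_sum]
    exact Finset.sum_eq_zero fun j _ => h j
  obtain ⟨j, hj⟩ := hex
  have hPs := isSelfAdjointFor_of_dirDeriv_eq (hPF i)
  have hQs := isSelfAdjointFor_of_dirDeriv_eq (hQG j)
  have hc : P i * Q j = Q j * P i := hPs.commute hd hfac hf hnd hQs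
  have h1 := (mul_eq_zero_or_eq_of_not_isDirectSumIn hd hfac hf hnd hQs (hP.idem i) (hQ.idem j)
    (hF.isHomogeneous i) (hPF i) (hF.not_isDirectSum i)).resolve_left hj
  have h2 := (mul_eq_zero_or_eq_of_not_isDirectSumIn hd hfac hf hnd hPs (hQ.idem j) (hP.idem i)
    (hG.isHomogeneous j) (hQG j) (hG.not_isDirectSum j)).resolve_left (hc ▸ hj)
  refine ⟨j, ext_dirDeriv hd1 (hF.isHomogeneous i) (hG.isHomogeneous j) fun v => ?_⟩
  rw [hPF, hQG, ← h1, hc, h2]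

theorem IsMaximallyFine.injective {d : ℕ} (hfac : ((d + 1).factorial : k) ≠ 0)
    {f : MvPolynomial (Fin n) k} {r : ℕ} {F : Fin r → MvPolynomial (Fin n) k}
    (hF : IsMaximallyFine d f F) : Function.Injective F := by
  intro i j hij
  exact hF.independent.injective
    (fun i => essentialVars_ne_bot hfac (hF.isHomogeneous i) (hF.ne_zero i))
    (congrArg (essentialVars d) hij)

end SmoothForm

end

theorem proposition4p3 {k : Type*} [Field k] (n d : ℕ) (hn : 2 ≤ n) (hd : 2 ≤ d)
    (hnd : n = 2 → 3 ≤ d) (hchar : ¬ ringChar k ∣ Nat.factorial (d + 1))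
    (f : MvPolynomial (Fin n) k) (hf : f.IsHomogeneous (d + 1)) (hsmooth : SmoothForm.IsSmooth f) :
    (∃ (r : ℕ) (F : Fin r → MvPolynomial (Fin n) k), SmoothForm.IsMaximallyFine d f F) ∧
      ∀ (r s : ℕ) (F : Fin r → MvPolynomial (Fin n) k) (G : Fin s → MvPolynomial (Fin n) k),
        SmoothForm.IsMaximallyFine d f F → SmoothForm.IsMaximallyFine d f G →
          ∃ e : Fin r ≃ Fin s, ∀ i, F i = G (e i) := by
  have hfac : ((d + 1).factorial : k) ≠ 0 := fun h => hchar ((ringChar.spec k _).1 h)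
  have hdfac : (d.factorial : k) ≠ 0 := by
    rw [Nat.factorial_succ, Nat.cast_mul] at hfac
    exact right_ne_zero_of_mul hfac
  have hker : ∀ c : Fin n → k, SmoothForm.dirDeriv c f = 0 → c = 0 := fun c hc =>
    hsmooth.eq_zero_of_dirDeriv_eq_zero hfac (by omega) hf hc
  refine ⟨?_, fun r s F G hF hG => ?_⟩
  · refine (SmoothForm.isDecomposition_singleton hf ?_
      (SmoothForm.essentialVars_eq_linearForms hf hdfac hker)).exists_isMaximallyFine hfac
    rintro rfl
    -- If `f` were zero, the all-ones vector would be a nonzero direction killing it.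
    have h1 := congrFun (hker (fun _ => 1) (map_zero _)) ⟨0, by omega⟩
    exact one_ne_zero h1
  · choose e he using fun i => hF.exists_eq hd hfac hf hker hG i
    have hinj : Function.Injective e := fun i j hij =>
      hF.injective hfac (by rw [he, he, hij])
    have hsurj : Function.Surjective e := fun j => by
      obtain ⟨i, hi⟩ := hG.exists_eq hd hfac hf hker hF j
      exact ⟨i, hG.injective hfac (by rw [← he, hi])⟩
    exact ⟨Equiv.ofBijective e ⟨hinj, hsurj⟩, he⟩
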